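/- Let $F$ be a dyadic local field, i.e. a nonarchimedean local field of characteristic $\neq 2$ with ring of integers $\mathfrak{o}$ and maximal ideal $\mathfrak{p}$ such that $2\in\mathfrak{p}$. Let $V$ be a $2$-dimensional $F$-vector space, $H\cong \mathrm{End}(V)$ a split quaternion algebra over $F$, and $\ddagger$ an orthogonal involution on $H$ (an $F$-linear anti-automorphism with $\ddagger^2=\mathrm{id}$, $\dim H^+=3$ and $\dim H^-=1$, where $H^\pm=\{x\in H : x^\ddagger=\pm x\}$). Conventions. The discriminant of $\ddagger$ is the square class $disc(\ddagger)=\mathrm{nrd}(h)(F^\times)^2$ for any nonzero $h\in H^-$, and $\iota(disc(\ddagger))=\bigcup_{\lambda\in disc(\ddagger)\cap\mathfrak{o}}\lambda\mathfrak{o}$. The ideal $disc(H)$ is $\mathfrak{p}$ if $H$ is a division algebra and $\mathfrak{o}$ otherwise. The quadratic defect of $\xi\in F$ is $\mathfrak{d}(\xi)=\bigcap\{\alpha\mathfrak{o} : \alpha\in F,\ \xi-\alpha \text{ is a square in } F\}$, and for $S\subset F$ we put $\mathfrak{d}(S)=\bigcup_{\xi\in S}\mathfrak{d}(\xi)$.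 A $\ddagger$-order is an $\mathfrak{o}$-order $\mathcal{O}$ of $H$ with $\mathcal{O}^\ddagger=\mathcal{O}$; it is maximal if it is not properly contained in another $\ddagger$-order. The discriminant $disc(\mathcal{O})$ of an order is its reduced discriminant: the ideal whose square is generated by all $\det(\mathrm{trd}(x_ix_j))_{1\le i,j\le 4}$ with $x_1,\dots,x_4\in\mathcal{O}$. For an $\mathfrak{o}$-lattice $\Lambda\subset V$ (a finitely generated $\mathfrak{o}$-submodule spanning $V$), $\mathrm{End}(\Lambda)=\{\sigma\in \mathrm{End}(V) : \sigma\Lambda\subset\Lambda\}$. Given a bilinear form $b$ on $V$, $\Lambda^\sharp=\{v\in V : b(v,\Lambda)\subset\mathfrak{o}\}$, and $\Lambda$ is $\mathfrak{a}$-modular, for a fractional ideal $\mathfrak{a}$ of $F$, if $\Lambda=\mathfrak{a}\Lambda^\sharp$. Theorem. Assume that $\mathfrak{d}(-disc(\ddagger)\cap\mathfrak{o})\neq\mathfrak{p}$. Then there is a nondegenerate symmetric bilinear form $b$ on $V$ inducing $\ddagger$, i.e. such that $b(v,\sigma w)=b(\sigma^{\ddagger}v,w)$ for all $v,w\in V$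 and $\sigma\in \mathrm{End}(V)\cong H$. For every such $b$ and every maximal $\ddagger$-order $\mathcal{O}$ of $H$ there exist a fractional ideal $\mathfrak{a}\subset F$ and an $\mathfrak{a}$-modular lattice $\Lambda\subset V$ such that $$\mathcal{O}=\mathrm{End}(\Lambda)\cap \mathrm{End}(\Lambda^\sharp)=\mathrm{End}(\Lambda).$$ Moreover, $disc(\mathcal{O})=disc(H)\cap\iota(disc(\ddagger))=\mathfrak{o}$ for every maximal $\ddagger$-order $\mathcal{O}$. -/

import Mathlib

open scoped ValuativeRel nonZeroDivisors

namespace QuatInv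

/-- An involution of the first kind: an `F`-linear anti-automorphism of order at most two. -/
structure Involution (F H : Type*) [Field F] [Ring H] [Algebra F H] extends H →ₗ[F] H where
  map_mul' : ∀ x y : H, toFun (x * y) = toFun y * toFun x
  involutive' : ∀ x : H, toFun (toFun x) = x

section Algebra

variable {F H V : Type*} [Field F] [Ring H] [Algebra F H] [AddCommGroup V] [Module F V]

instance : CoeFun (Involution F H) (fun _ => H → H) := ⟨fun s => s.toLinearMap⟩

/-- The space `H⁺` of symmetric elements. -/
def Involution.symmetricPart (s : Involution F H) : Submodule F H where
  carrier := {x | s x = x}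
  add_mem' {x y} hx hy := by
    simp only [Set.mem_ofPred_eq] at hx hy ⊢
    rw [map_add, hx, hy]
  zero_mem' := by simp
  smul_mem' c x hx := by
    simp only [Set.mem_ofPred_eq] at hx ⊢
    rw [map_smul, hx]

/-- The space `H⁻` of skew-symmetric elements. -/
def Involution.skewPart (s : Involution F H) : Submodule F H where
  carrier := {x | s x = -x}
  add_mem' {x y} hx hy := by
    simp only [Set.mem_ofPred_eq] at hx hy ⊢
    rw [map_add, hx, hy, neg_add]
  zero_mem' := by simp
  smul_mem' c x hx := by
    simp only [Set.mem_ofPred_eq] at hx ⊢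
    rw [map_smul, hx, smul_neg]

/-- An involution of a quaternion algebra (degree `n = 2`) is orthogonal if
`dim H⁺ = n (n + 1) / 2 = 3` and `dim H⁻ = n (n - 1) / 2 = 1`. -/
def Involution.IsOrthogonal (s : Involution F H) : Prop :=
  Module.finrank F s.symmetricPart = 3 ∧ Module.finrank F s.skewPart = 1

/-- The reduced norm of a split algebra `H ≅ End(V)`. -/
noncomputable def nrd (Φ : H ≃ₐ[F] Module.End F V) (x : H) : F := LinearMap.det (Φ x)

/-- The reduced trace of a split algebra `H ≅ End(V)`. -/
noncomputable def trd (Φ : H ≃ₐ[F] Module.End F V) (x : H) : F := LinearMap.trace F V (Φ x)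

/-- The discriminant of an orthogonal involution, a coset of `(Fˣ)²` in `Fˣ`, as a subset of `F`:
the products `nrd h * u ^ 2` with `h ∈ H⁻` nonzero and `u ∈ Fˣ`. -/
def Involution.disc (s : Involution F H) (Φ : H ≃ₐ[F] Module.End F V) : Set F :=
  {l | ∃ h ∈ s.skewPart, h ≠ 0 ∧ ∃ u : F, u ≠ 0 ∧ l = nrd Φ h * u ^ 2}

/-- The symmetric nondegenerate bilinear form `b` on `V` induces the involution `s` of
`H ≅ End(V)`: `b (v, σ w) = b (σ^s v, w)`. -/
def Involution.IsInducedBy (s : Involution F H) (Φ : H ≃ₐ[F] Module.End F V)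
    (b : LinearMap.BilinForm F V) : Prop :=
  b.IsSymm ∧ b.Nondegenerate ∧ ∀ (σ : H) (v w : V), b v (Φ σ w) = b (Φ (s σ) v) w

end Algebra

section Local

variable {F H V : Type*} [Field F] [ValuativeRel F] [TopologicalSpace F]
  [IsNonarchimedeanLocalField F] [Ring H] [Algebra F H] [AddCommGroup V] [Module F V]

/-- The quadratic defect of `x`: the intersection of all `α 𝔬` with `x = η ^ 2 + α`. -/
noncomputable def quadraticDefect (x : F) : Submodule 𝒪[F] F :=
  ⨅ α ∈ {α : F | ∃ η : F, x = η ^ 2 + α}, Submodule.span 𝒪[F] {α}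

/-- The quadratic defect of a set: the union (that is, the largest, as these form a chain)
of the quadratic defects of its elements. -/
noncomputable def quadraticDefectSet (S : Set F) : Submodule 𝒪[F] F :=
  ⨆ x ∈ S, quadraticDefect x

/-- The maximal ideal `𝔭` of `𝔬`, as a fractional ideal in `F`. -/
noncomputable def maximalIdealInField (F : Type*) [Field F] [ValuativeRel F] [TopologicalSpace F]
    [IsNonarchimedeanLocalField F] : Submodule 𝒪[F] F :=
  IsLocalization.coeSubmodule F 𝓂[F]

/-- The ideal `ι(S)` of `𝔬` attached to a square class `S`: the union of all `l 𝔬` with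
`l ∈ S ∩ 𝔬`. -/
noncomputable def iotaIdeal (S : Set F) : Ideal 𝒪[F] := Ideal.span {l : 𝒪[F] | (l : F) ∈ S}

open Classical in
/-- The discriminant of a quaternion algebra over a local field: `𝔭` if it is a division
algebra (ramified), and `𝔬` otherwise. -/
noncomputable def algebraDisc (F H : Type*) [Field F] [ValuativeRel F] [TopologicalSpace F]
    [IsNonarchimedeanLocalField F] [Ring H] [Algebra F H] : Ideal 𝒪[F] :=
  if ∀ x : H, x ≠ 0 → IsUnit x then 𝓂[F] else ⊤

/-- An `s`-order: an `𝔬`-order (a subring that is a full `𝔬`-lattice) with `O^s = O`. -/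
def IsInvolutionOrder (s : Involution F H) (O : Subalgebra 𝒪[F] H) : Prop :=
  Submodule.IsLattice F (Subalgebra.toSubmodule O) ∧ s '' (O : Set H) = O

/-- A maximal `s`-order: one not properly contained in any other `s`-order. -/
def IsMaximalInvolutionOrder (s : Involution F H) (O : Subalgebra 𝒪[F] H) : Prop :=
  Maximal (IsInvolutionOrder s) O

/-- The ideal generated by all `det (trd (xᵢ xⱼ))` with `x₁, …, x₄ ∈ O`. -/
noncomputable def discIdeal (Φ : H ≃ₐ[F] Module.End F V) (O : Subalgebra 𝒪[F] H) : Ideal 𝒪[F] :=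
  Ideal.span {d : 𝒪[F] | ∃ x : Fin 4 → H, (∀ i, x i ∈ O) ∧
    (d : F) = Matrix.det (Matrix.of fun i j : Fin 4 => trd Φ (x i * x j))}

/-- `𝔡` is the (reduced) discriminant of the order `O`: the unique ideal whose square is
generated by all `det (trd (xᵢ xⱼ))` with `x₁, …, x₄ ∈ O`. -/
def IsReducedDisc (Φ : H ≃ₐ[F] Module.End F V) (O : Subalgebra 𝒪[F] H) (𝔡 : Ideal 𝒪[F]) :
    Prop :=
  𝔡 ^ 2 = discIdeal Φ O

/-- The order `End(Λ)`, inside `H ≅ End(V)`. -/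
noncomputable def latticeEnd (Φ : H ≃ₐ[F] Module.End F V) (L : Submodule 𝒪[F] V) : Subalgebra 𝒪[F] H where
  carrier := {x | ∀ v ∈ L, Φ x v ∈ L}
  mul_mem' {x y} hx hy v hv := by
    rw [map_mul, Module.End.mul_apply]
    exact hx _ (hy _ hv)
  add_mem' {x y} hx hy v hv := by
    rw [map_add, LinearMap.add_apply]
    exact L.add_mem (hx _ hv) (hy _ hv)
  algebraMap_mem' r v hv := by
    have h : algebraMap 𝒪[F] H r = algebraMap F H (r : F) := rfl
    rw [h, AlgEquiv.commutes, Module.algebraMap_end_apply]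
    exact L.smul_mem r hv

/-- `Λ` is `𝔞`-modular with respect to `b`: it is a lattice with `Λ = 𝔞 Λ♯`, where
`Λ♯ = {v | b (v, Λ) ⊆ 𝔬}` is the dual lattice. -/
def IsIdealModular (b : LinearMap.BilinForm F V) (𝔞 : FractionalIdeal 𝒪[F]⁰ F)
    (L : Submodule 𝒪[F] V) : Prop :=
  Submodule.IsLattice F L ∧ L = (𝔞 : Submodule 𝒪[F] F) • b.dualSubmodule L

end Local

end QuatInv

/-! The defect hypothesis says that the discriminant class contains a unit. Otherwise it contains a
uniformizer `ϖ`, every integral element of the negated class lies in `𝔭`, and `-ϖ` has defect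
exactly `𝔭` (`Involution.exists_unit_mem_disc`).

By Skolem–Noether the involution is adjoint to a form, and orthogonality makes the form symmetric.
The Gram determinant times `nrd h`, for `h` skew, is a square (`gramDet_mul_nrd`), so the form has
unit discriminant up to squares.

A stable order `O` preserves a lattice. Either that lattice is modular, or it is `⟨a, c⟩` with `|c|
≤ |a|`; unit discriminant then gives `|c| = |k|²|a|`, and dividing the second vector by `k` makes
the lattice modular. Adjointness confines one off-diagonal entry of each element of `O` to `k²𝔬`, so
`O` preserves the new lattice too (`le_latticeEnd_isUnitSMul`). Since `End(Λ)` is stable for modular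
`Λ`, maximality gives `O = End(Λ)`, a copy of `M₂(𝔬)`, whose discriminant is `𝔬`. -/

namespace QuatInv

/-! ### Involutions of `End V` and their adjoint forms -/

section Algebra

variable {F H V : Type*} [Field F] [Ring H] [Algebra F H] [AddCommGroup V] [Module F V]

theorem Involution.map_mul (s : Involution F H) (x y : H) : s (x * y) = s y * s x :=
  s.map_mul' x y

theorem Involution.apply_apply (s : Involution F H) (x : H) : s (s x) = x :=
  s.involutive' x

theorem Involution.map_one (s : Involution F H) : s 1 = 1 := by
  have h := s.map_mul (s 1) 1
  rwa [mul_one, s.apply_apply, mul_one, eq_comm] at h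

theorem Involution.mem_skewPart {s : Involution F H} {x : H} : x ∈ s.skewPart ↔ s x = -x :=
  Iff.rfl

theorem Involution.mem_symmetricPart {s : Involution F H} {x : H} :
    x ∈ s.symmetricPart ↔ s x = x :=
  Iff.rfl

/-- The action of `End V` on the dual space of `V` through an involution. -/
noncomputable def Involution.dualAction (s : Involution F H) (Φ : H ≃ₐ[F] Module.End F V) :
    Module.End F V →ₐ[F] Module.End F (Module.Dual F V) :=
  AlgHom.ofLinearMap
    (Module.Dual.transpose ∘ₗ Φ.toLinearMap ∘ₗ s.toLinearMap ∘ₗ Φ.symm.toLinearMap)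
    (by
      ext f v
      simp [Module.Dual.transpose_apply, s.map_one])
    (by
      intro x y
      ext f v
      simp [Module.Dual.transpose_apply, s.map_mul])

theorem Involution.dualAction_apply (s : Involution F H) (Φ : H ≃ₐ[F] Module.End F V)
    (x : H) (f : Module.Dual F V) (w : V) :
    s.dualAction Φ (Φ x) f w = f (Φ (s x) w) := by
  simp [Involution.dualAction, Module.Dual.transpose_apply]

/-- Functionals separate points, which gives injectivity; `V` and its dual have equal dimension,
which gives the rest. The resulting isomorphism of endomorphism algebras is the input to
Skolem–Noether. -/
theorem Involution.dualAction_bijective [FiniteDimensional F V] (s : Involution F H)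
    (Φ : H ≃ₐ[F] Module.End F V) : Function.Bijective (s.dualAction Φ) := by
  have hinj : Function.Injective (s.dualAction Φ) := by
    rw [injective_iff_map_eq_zero]
    intro X hX
    obtain ⟨x, rfl⟩ := Φ.surjective X
    have h0 : Φ (s x) = 0 := by
      ext w
      refine (Module.forall_dual_apply_eq_zero_iff F _).mp fun f => ?_
      rw [← s.dualAction_apply Φ]
      simpa using congrArg (fun g : Module.End F (Module.Dual F V) => g f w) hX
    have h1 : s x = 0 := by simpa using h0
    have h2 := s.apply_apply x
    rw [h1, _root_.map_zero] at h2
    rw [← h2, _root_.map_zero]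
  refine ⟨hinj, ?_⟩
  let f : (V →ₗ[F] V) →ₗ[F] (Module.Dual F V →ₗ[F] Module.Dual F V) := (s.dualAction Φ).toLinearMap
  have hrank : Module.finrank F (V →ₗ[F] V) =
      Module.finrank F (Module.Dual F V →ₗ[F] Module.Dual F V) := by
    rw [Module.finrank_linearMap, Module.finrank_linearMap, Subspace.dual_finrank_eq]
  have hiff : Function.Injective f ↔ Function.Surjective f :=
    LinearMap.injective_iff_surjective_of_finrank_eq_finrank (K := F) (V := V →ₗ[F] V)
      (V₂ := Module.Dual F V →ₗ[F] Module.Dual F V) hrank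
  exact hiff.mp hinj

/-- Every involution of `End V` is adjoint to a nondegenerate bilinear form. -/
theorem Involution.exists_adjoint_form [FiniteDimensional F V] (s : Involution F H)
    (Φ : H ≃ₐ[F] Module.End F V) :
    ∃ g : V ≃ₗ[F] Module.Dual F V, ∀ (x : H) (v w : V), g (Φ x v) w = g v (Φ (s x) w) := by
  -- Skolem–Noether: the isomorphism is conjugation by some linear `g : V ≃ V*`, which is the form
  -- sought.
  obtain ⟨g, hg⟩ := (AlgEquiv.ofBijective _ (s.dualAction_bijective Φ)).eq_linearEquivConjAlgEquiv
  refine ⟨g, fun x v w => ?_⟩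
  have h := congrArg (fun f => f (Φ x) (g v) w) hg
  simp only [AlgEquiv.coe_ofBijective, s.dualAction_apply, LinearEquiv.conjAlgEquiv_apply] at h
  simpa using h.symm

/-- A bilinear form adjoint to an involution is symmetric or alternating up to a scalar. -/
theorem Involution.exists_flip_eq_smul [FiniteDimensional F V] (s : Involution F H)
    (Φ : H ≃ₐ[F] Module.End F V) (g : V ≃ₗ[F] Module.Dual F V)
    (hg : ∀ (x : H) (v w : V), g (Φ x v) w = g v (Φ (s x) w)) :
    ∃ c : F, ∀ v w : V, g w v = c * g v w := by
  -- The asymmetry of `g`. It commutes with every endomorphism because `s` is involutive, hence is a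
  -- scalar.
  let T : Module.End F V := g.symm.toLinearMap ∘ₗ (g : V →ₗ[F] V →ₗ[F] F).flip
  have hT : ∀ v w : V, g (T v) w = g w v := fun v w => by simp [T]
  have hc : T ∈ Subalgebra.center F (Module.End F V) := by
    rw [Subalgebra.mem_center_iff]
    intro X
    obtain ⟨x, rfl⟩ := Φ.surjective X
    ext v
    refine g.injective (LinearMap.ext fun w => ?_)
    rw [Module.End.mul_apply, Module.End.mul_apply, hg, hT, hT]
    have h := hg (s x) w v
    rwa [s.apply_apply] at h
  rw [Algebra.IsCentral.center_eq_bot, Algebra.mem_bot] at hc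
  obtain ⟨c, hc⟩ := hc
  refine ⟨c, fun v w => ?_⟩
  rw [← hT, ← hc]
  simp [Module.algebraMap_end_apply]

/-- If an adjoint form of an involution of a quaternion algebra is antisymmetric, then every
symmetric element is a scalar. -/
theorem Involution.finrank_symmetricPart_le_one (h2 : (2 : F) ≠ 0)
    (hV : Module.finrank F V = 2) (s : Involution F H)
    (Φ : H ≃ₐ[F] Module.End F V) (g : V ≃ₗ[F] Module.Dual F V)
    (hg : ∀ (x : H) (v w : V), g (Φ x v) w = g v (Φ (s x) w))
    (hanti : ∀ v w : V, g w v = - g v w) :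
    Module.finrank F s.symmetricPart ≤ 1 := by
  have hself : ∀ v, g v v = 0 := fun v => by
    have h : 2 * g v v = 0 := by linear_combination hanti v v
    exact (mul_eq_zero.mp h).resolve_left h2
  have : FiniteDimensional F V := Module.finite_of_finrank_eq_succ hV
  let e := Module.finBasisOfFinrankEq F V hV
  have h01 : g (e 0) (e 1) ≠ 0 := fun h => by
    refine e.ne_zero 0 (g.injective (e.ext fun i => ?_))
    fin_cases i
    · simpa using hself (e 0)
    · simpa using h
  refine finrank_le_one (⟨1, s.map_one⟩ : s.symmetricPart) ?_
  rintro ⟨x, hx⟩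
  rw [Involution.mem_symmetricPart] at hx
  have hxs : ∀ v w, g (Φ x v) w = g v (Φ x w) := fun v w => by rw [hg, hx]
  -- `g (Φ x v) w` is alternating in `v, w`; on a plane it is therefore a multiple of `g`, which
  -- makes `x` scalar.
  have hx0 : ∀ v, g (Φ x v) v = 0 := fun v => by
    have h : 2 * g (Φ x v) v = 0 := by linear_combination hxs v v + hanti (Φ x v) v
    exact (mul_eq_zero.mp h).resolve_left h2
  have e0 := e.sum_repr (Φ x (e 0))
  have e1 := e.sum_repr (Φ x (e 1))
  rw [Fin.sum_univ_two] at e0 e1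
  set α := e.repr (Φ x (e 0)) 0
  set β := e.repr (Φ x (e 0)) 1
  set γ := e.repr (Φ x (e 1)) 0
  set δ := e.repr (Φ x (e 1)) 1
  have h00 := hx0 (e 0)
  have h11 := hx0 (e 1)
  have hs01 := hxs (e 0) (e 1)
  simp only [← e0, ← e1, _root_.map_add, _root_.map_smul, LinearMap.add_apply,
    LinearMap.smul_apply, smul_eq_mul, hself, mul_zero, zero_add, add_zero] at h00 h11 hs01
  rw [hanti (e 0) (e 1)] at h00
  have hβ : β = 0 := by simpa [h01] using h00
  have hγ : γ = 0 := by simpa [h01] using h11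
  have hδ : α = δ := mul_right_cancel₀ h01 hs01
  refine ⟨α, Subtype.ext (Φ.injective (e.ext fun i => ?_))⟩
  fin_cases i
  · simp [← e0, hβ]
  · simp [← e1, hγ, hδ]

/-- An orthogonal involution of a split quaternion algebra is induced by a symmetric form. -/
theorem Involution.IsOrthogonal.exists_isInducedBy (h2 : (2 : F) ≠ 0)
    (hV : Module.finrank F V = 2) (Φ : H ≃ₐ[F] Module.End F V) {s : Involution F H}
    (hs : s.IsOrthogonal) : ∃ b : LinearMap.BilinForm F V, s.IsInducedBy Φ b := by
  have : FiniteDimensional F V := Module.finite_of_finrank_eq_succ hV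
  have : Nontrivial V := Module.nontrivial_of_finrank_pos (R := F) (by omega)
  obtain ⟨g, hg⟩ := s.exists_adjoint_form Φ
  obtain ⟨c, hc⟩ := s.exists_flip_eq_smul Φ g hg
  obtain ⟨v, w, hvw⟩ : ∃ v w, g v w ≠ 0 := by
    obtain ⟨v, hv⟩ := exists_ne (0 : V)
    by_contra! h
    exact hv (g.injective (LinearMap.ext fun w => by simpa using h v w))
  have hcc : c = 1 ∨ c = -1 := by
    refine mul_self_eq_one_iff.mp (mul_right_cancel₀ hvw ?_)
    linear_combination - hc w v - c * hc v w
  have hc1 : c = 1 := by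
    refine hcc.resolve_right fun h => ?_
    have := s.finrank_symmetricPart_le_one h2 hV Φ g hg fun v w => by rw [hc v w, h, neg_one_mul]
    rw [hs.1] at this
    omega
  have hsymm : ∀ v w, g w v = g v w := fun v w => by rw [hc v w, hc1, one_mul]
  refine ⟨(g : V →ₗ[F] V →ₗ[F] F), ⟨fun v w => hsymm w v⟩, ?_, fun σ v w => ?_⟩
  · have hl : ∀ v : V, (∀ w, g v w = 0) → v = 0 := fun v hv =>
      g.injective (LinearMap.ext fun w => by simpa using hv w)
    exact ⟨hl, fun v hv => hl v fun w => by rw [← hsymm]; exact hv w⟩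
  · have h := hg (s σ) v w
    rw [s.apply_apply] at h
    exact h.symm

/-! ### Discriminant of the form, and matrix units -/

/-- The determinant of the Gram matrix of a symmetric form in dimension two. -/
noncomputable def gramDet (b : LinearMap.BilinForm F V) (e : Module.Basis (Fin 2) F V) : F :=
  b (e 0) (e 0) * b (e 1) (e 1) - b (e 0) (e 1) ^ 2

/-- The discriminant of the form equals the discriminant of the involution up to squares. -/
theorem Involution.IsInducedBy.gramDet_mul_nrd {s : Involution F H} {Φ : H ≃ₐ[F] Module.End F V}
    {b : LinearMap.BilinForm F V} (hb : s.IsInducedBy Φ b) (h2 : (2 : F) ≠ 0)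
    (e : Module.Basis (Fin 2) F V) {h : H} (hh : h ∈ s.skewPart) (h0 : h ≠ 0) :
    ∃ t : F, t ≠ 0 ∧ gramDet b e * nrd Φ h = t ^ 2 := by
  obtain ⟨hsymm, hnd, hadj⟩ := hb
  have hskew : ∀ v w, b v (Φ h w) = - b w (Φ h v) := fun v w => by
    rw [hadj, Involution.mem_skewPart.mp hh, hsymm.eq w]
    simp
  have hself : ∀ v, b v (Φ h v) = 0 := fun v => by
    have h : 2 * b v (Φ h v) = 0 := by linear_combination hskew v v
    exact (mul_eq_zero.mp h).resolve_left h2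
  have e0 := e.sum_repr (Φ h (e 0))
  have e1 := e.sum_repr (Φ h (e 1))
  rw [Fin.sum_univ_two] at e0 e1
  have hdet : nrd Φ h = e.repr (Φ h (e 0)) 0 * e.repr (Φ h (e 1)) 1 -
      e.repr (Φ h (e 1)) 0 * e.repr (Φ h (e 0)) 1 := by
    rw [nrd, ← LinearMap.det_toMatrix e, Matrix.det_fin_two]
    simp only [LinearMap.toMatrix_apply]
  -- The form `b v (Φ h w)` is alternating, with Gram matrix that of `b` times that of `h`; its
  -- determinant is the square of this entry. If the entry vanished, so would the form and `h`.
  refine ⟨b (e 0) (Φ h (e 1)), fun ht => h0 ?_, ?_⟩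
  · have hz : ∀ i j, b (e i) (Φ h (e j)) = 0 := by
      intro i j
      fin_cases i <;> fin_cases j
      · exact hself _
      · exact ht
      · exact (hskew _ _).trans (by rw [neg_eq_zero]; exact ht)
      · exact hself _
    refine Φ.injective ((e.ext fun j => hnd.2 _ fun v => ?_).trans (_root_.map_zero Φ).symm)
    have : b.flip (Φ h (e j)) = 0 := e.ext fun i => hz i j
    exact LinearMap.congr_fun this v
  · have h00 := hself (e 0)
    have h11 := hself (e 1)
    have h01 := hskew (e 0) (e 1)
    rw [hdet, gramDet]
    set α := e.repr (Φ h (e 0)) 0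
    set β := e.repr (Φ h (e 0)) 1
    set γ := e.repr (Φ h (e 1)) 0
    set δ := e.repr (Φ h (e 1)) 1
    have h10 := hsymm.eq (e 1) (e 0)
    simp only [← e0, ← e1, _root_.map_add, _root_.map_smul, smul_eq_mul, h10] at h00 h11 h01 ⊢
    linear_combination (γ * b (e 0) (e 1) + δ * b (e 1) (e 1)) * h00 -
      (γ * b (e 0) (e 0) + δ * b (e 0) (e 1)) * h01

/-- The basis of matrix units of `H ≅ End V`. -/
noncomputable def matrixUnitBasis (Φ : H ≃ₐ[F] Module.End F V) (e : Module.Basis (Fin 2) F V) :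
    Module.Basis (Fin 2 × Fin 2) F H :=
  (Matrix.stdBasis F (Fin 2) (Fin 2)).map
    (Φ.trans (LinearMap.toMatrixAlgEquiv e)).symm.toLinearEquiv

theorem matrixUnitBasis_repr (Φ : H ≃ₐ[F] Module.End F V) (e : Module.Basis (Fin 2) F V) (x : H)
    (ij : Fin 2 × Fin 2) :
    (matrixUnitBasis Φ e).repr x ij = e.repr (Φ x (e ij.2)) ij.1 := by
  simp [matrixUnitBasis, Matrix.stdBasis, LinearMap.toMatrixAlgEquiv_apply]

theorem trd_symm_mul_symm (Φ : H ≃ₐ[F] Module.End F V) (e : Module.Basis (Fin 2) F V)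
    (A B : Matrix (Fin 2) (Fin 2) F) :
    trd Φ ((Φ.trans (LinearMap.toMatrixAlgEquiv e)).symm A *
      (Φ.trans (LinearMap.toMatrixAlgEquiv e)).symm B) = (A * B).trace := by
  rw [← map_mul, trd, LinearMap.trace_eq_matrix_trace F e]
  congr 1
  exact (Φ.trans (LinearMap.toMatrixAlgEquiv e)).apply_symm_apply (A * B)

end Algebra

/-! ### Integrality in terms of the valuation -/

section Integer

open ValuativeRel

variable {F : Type*} [Field F] [ValuativeRel F]

theorem integer_isUnit_iff {x : 𝒪[F]} : IsUnit x ↔ valuation F (x : F) = 1 :=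
  (Valuation.integer.integers (valuation F)).isUnit_iff_valuation_eq_one

theorem mem_span_singleton_of_valuation_le {x y : F} (h : valuation F x ≤ valuation F y) :
    x ∈ Submodule.span 𝒪[F] {y} := by
  rcases eq_or_ne y 0 with rfl | hy
  · have : x = 0 := by simpa using h
    simp [this]
  · refine Submodule.mem_span_singleton.mpr ⟨⟨x / y, ?_⟩, ?_⟩
    · rw [Valuation.mem_integer_iff, map_div₀]
      exact div_le_one_of_le₀ h zero_le
    · exact div_mul_cancel₀ x hy

theorem isLattice_span_range_basis {ι W : Type*} [Finite ι] [AddCommGroup W] [Module F W]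
    (e : Module.Basis ι F W) : Submodule.IsLattice F (Submodule.span 𝒪[F] (Set.range e)) where
  fg := Submodule.fg_span (Set.finite_range e)
  span_eq_top := by rw [Submodule.span_span_of_tower, e.span_eq]

theorem iotaIdeal_eq_top {S : Set F} {z : F} (hz : z ∈ S) (h1 : valuation F z = 1) :
    iotaIdeal S = ⊤ :=
  Ideal.eq_top_of_isUnit_mem _ (x := ⟨z, h1.le⟩) (Ideal.subset_span hz)
    (integer_isUnit_iff.mpr h1)

end Integer

/-! ### Square classes and the quadratic defect -/

section Local

open ValuativeRel

variable {F H V : Type*} [Field F] [ValuativeRel F] [TopologicalSpace F]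
  [IsNonarchimedeanLocalField F] [Ring H] [Algebra F H] [AddCommGroup V] [Module F V]

theorem integer_mem_maximalIdeal_iff {x : 𝒪[F]} : x ∈ 𝓂[F] ↔ valuation F (x : F) < 1 := by
  rw [IsLocalRing.mem_maximalIdeal, mem_nonunits_iff, integer_isUnit_iff]
  exact ⟨fun h => lt_of_le_of_ne x.2 h, fun h => h.ne⟩

/-- Every square class contains a unit or a uniformizer. -/
theorem exists_mul_sq_unit_or_irreducible {x : F} (hx : x ≠ 0) :
    ∃ u : F, u ≠ 0 ∧ (valuation F (x * u ^ 2) = 1 ∨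
      ∃ ϖ : 𝒪[F], Irreducible ϖ ∧ x * u ^ 2 = ϖ) := by
  obtain ⟨ϖ, hϖ⟩ := IsDiscreteValuationRing.exists_irreducible 𝒪[F]
  obtain ⟨n, w, hw⟩ := IsDiscreteValuationRing.exists_units_eq_smul_zpow_of_irreducible hϖ hx
  have hϖ0 : (ϖ : F) ≠ 0 := by simpa using hϖ.ne_zero
  have hw' : x = (w : 𝒪[F]) * (ϖ : F) ^ n := hw
  obtain ⟨m, rfl⟩ | ⟨m, rfl⟩ := Int.even_or_odd n
  · refine ⟨(ϖ : F) ^ (-m), zpow_ne_zero _ hϖ0, Or.inl ?_⟩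
    have : x * ((ϖ : F) ^ (-m)) ^ 2 = (w : 𝒪[F]) := by
      rw [hw', zpow_add₀ hϖ0, zpow_neg]
      have := zpow_ne_zero m hϖ0
      field_simp
    rw [this]
    exact integer_isUnit_iff.mp w.isUnit
  · refine ⟨(ϖ : F) ^ (-m), zpow_ne_zero _ hϖ0, Or.inr ⟨w * ϖ, ?_, ?_⟩⟩
    · exact (irreducible_units_mul w).mpr hϖ
    · rw [hw', two_mul, zpow_add₀ hϖ0, zpow_add₀ hϖ0, zpow_neg, zpow_one]
      have := zpow_ne_zero m hϖ0
      push_cast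
      field_simp

theorem mem_maximalIdealInField {x : F} : x ∈ maximalIdealInField F ↔ valuation F x < 1 := by
  rw [maximalIdealInField, IsLocalization.mem_coeSubmodule]
  constructor
  · rintro ⟨y, hy, rfl⟩
    exact integer_mem_maximalIdeal_iff.mp hy
  · intro hx
    exact ⟨⟨x, hx.le⟩, integer_mem_maximalIdeal_iff.mpr hx, rfl⟩

theorem valuation_le_of_irreducible {ϖ : 𝒪[F]} (hϖ : Irreducible ϖ) {x : F}
    (hx : valuation F x < 1) : valuation F x ≤ valuation F (ϖ : F) := by
  have hmem : (⟨x, hx.le⟩ : 𝒪[F]) ∈ 𝓂[F] := integer_mem_maximalIdeal_iff.mpr hx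
  rw [hϖ.maximalIdeal_eq, Ideal.mem_span_singleton] at hmem
  obtain ⟨a, ha⟩ := hmem
  have ha' : x = ϖ * a := congrArg Subtype.val ha
  rw [ha', map_mul]
  exact mul_le_of_le_one_right' a.2

/-- If `-ϖ = η² + α` with `|α| < |ϖ|`, then `|η|² = |ϖ| < 1`; but `|η| < 1` forces `|η| ≤ |ϖ|`, so
`|ϖ| ≤ |ϖ|²`, which is absurd. -/
theorem le_quadraticDefect_neg_of_irreducible {ϖ : 𝒪[F]} (hϖ : Irreducible ϖ) :
    maximalIdealInField F ≤ quadraticDefect (-(ϖ : F)) := by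
  have h1 : valuation F (ϖ : F) < 1 := integer_mem_maximalIdeal_iff.mp
    ((IsLocalRing.mem_maximalIdeal _).mpr hϖ.not_isUnit)
  have h0 : 0 < valuation F (ϖ : F) :=
    (Valuation.pos_iff _).mpr (by simpa using hϖ.ne_zero)
  refine le_iInf₂ fun α ⟨η, hη⟩ x hx => mem_span_singleton_of_valuation_le ?_
  refine (valuation_le_of_irreducible hϖ (mem_maximalIdealInField.mp hx)).trans ?_
  by_contra! hlt
  have hsq : valuation F η ^ 2 = valuation F (ϖ : F) := by
    rw [← map_pow, show η ^ 2 = -((ϖ : F) + α) by linear_combination -hη, Valuation.map_neg]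
    exact Valuation.map_add_eq_of_lt_left _ hlt
  have hη1 : valuation F η < 1 := by
    by_contra! h
    exact absurd (hsq ▸ h1) (not_lt.mpr (one_le_pow_of_one_le' h 2))
  have hle := valuation_le_of_irreducible hϖ hη1
  have : valuation F (ϖ : F) ≤ valuation F (ϖ : F) * valuation F (ϖ : F) :=
    calc valuation F (ϖ : F) = valuation F η * valuation F η := by rw [← hsq, sq]
      _ ≤ _ := mul_le_mul' hle hle
  exact absurd this (not_le.mpr (mul_lt_of_lt_one_right h0 h1))

/-- The hypothesis on the quadratic defect forces the discriminant to contain a unit. -/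
theorem Involution.exists_unit_mem_disc {s : Involution F H} {Φ : H ≃ₐ[F] Module.End F V} {h : H}
    (hh : h ∈ s.skewPart) (h0 : h ≠ 0) (hn : nrd Φ h ≠ 0)
    (hdefect : quadraticDefectSet {x : F | x ∈ 𝒪[F] ∧ -x ∈ s.disc Φ} ≠ maximalIdealInField F) :
    ∃ z ∈ s.disc Φ, valuation F z = 1 := by
  by_contra! hno
  obtain ⟨u, hu, hval | ⟨ϖ, hϖ, hval⟩⟩ := exists_mul_sq_unit_or_irreducible hn
  · exact hno _ ⟨h, hh, h0, u, hu, rfl⟩ hval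
  -- Without units in the class, the choice `η = 0` puts each defect inside `x𝔬 ⊆ 𝔭`; the element
  -- `-ϖ` attains `𝔭`.
  refine hdefect (le_antisymm (iSup₂_le fun x hx => ?_) ?_)
  · refine iInf₂_le_of_le x ⟨0, by simp⟩ ?_
    rw [Submodule.span_singleton_le_iff_mem, mem_maximalIdealInField]
    refine lt_of_le_of_ne hx.1 fun h1 => hno _ hx.2 ?_
    rwa [Valuation.map_neg]
  · refine le_iSup₂_of_le (-(ϖ : F)) ⟨neg_mem ϖ.2, ?_⟩ (le_quadraticDefect_neg_of_irreducible hϖ)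
    rw [neg_neg]
    exact ⟨h, hh, h0, u, hu, hval.symm⟩

/-! ### Lattices with a basis and their endomorphism orders -/

theorem mem_span_range_basis_iff {ι W : Type*} [AddCommGroup W] [Module F W]
    (e : Module.Basis ι F W) {x : W} :
    x ∈ Submodule.span 𝒪[F] (Set.range e) ↔ ∀ i, valuation F (e.repr x i) ≤ 1 := by
  rw [e.mem_span_iff_repr_mem 𝒪[F] x]
  refine forall_congr' fun i => ⟨?_, fun h => ⟨⟨_, h⟩, rfl⟩⟩
  rintro ⟨y, hy⟩
  rw [← hy]
  exact y.2

theorem mem_latticeEnd_span_range_iff {Φ : H ≃ₐ[F] Module.End F V}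
    (e : Module.Basis (Fin 2) F V) {x : H} :
    x ∈ latticeEnd Φ (Submodule.span 𝒪[F] (Set.range e)) ↔
      ∀ i j, valuation F (e.repr (Φ x (e j)) i) ≤ 1 := by
  constructor
  · intro h i j
    exact (mem_span_range_basis_iff e).mp (h _ (Submodule.subset_span ⟨j, rfl⟩)) i
  · intro h w hw
    rw [mem_span_range_basis_iff] at hw ⊢
    intro i
    rw [← e.sum_repr w]
    simp only [Fin.sum_univ_two, map_add, map_smul, Finsupp.add_apply, Finsupp.smul_apply,
      smul_eq_mul]
    refine Valuation.map_add_le _ ?_ ?_ <;> rw [map_mul] <;>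
      exact mul_le_one' (hw _) (h _ _)

theorem latticeEnd_span_range_eq (Φ : H ≃ₐ[F] Module.End F V) (e : Module.Basis (Fin 2) F V) :
    Subalgebra.toSubmodule (latticeEnd Φ (Submodule.span 𝒪[F] (Set.range e))) =
      Submodule.span 𝒪[F] (Set.range (matrixUnitBasis Φ e)) := by
  ext x
  rw [Subalgebra.mem_toSubmodule, mem_latticeEnd_span_range_iff, mem_span_range_basis_iff]
  simp only [matrixUnitBasis_repr, Prod.forall]

/-- On the matrix units the trace form is the permutation matrix of a transposition, so its
determinant is the unit `-1`. -/
theorem discIdeal_latticeEnd_span_range (Φ : H ≃ₐ[F] Module.End F V)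
    (e : Module.Basis (Fin 2) F V) :
    discIdeal Φ (latticeEnd Φ (Submodule.span 𝒪[F] (Set.range e))) = ⊤ := by
  refine Ideal.eq_top_of_isUnit_mem _ (x := -1) (Ideal.subset_span ?_) isUnit_one.neg
  let A : Fin 4 → Matrix (Fin 2) (Fin 2) F :=
    ![!![1, 0; 0, 0], !![0, 1; 0, 0], !![0, 0; 1, 0], !![0, 0; 0, 1]]
  refine ⟨fun k => (Φ.trans (LinearMap.toMatrixAlgEquiv e)).symm (A k), fun k => ?_, ?_⟩
  · rw [mem_latticeEnd_span_range_iff]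
    intro i j
    have h : e.repr (Φ ((Φ.trans (LinearMap.toMatrixAlgEquiv e)).symm (A k)) (e j)) i =
        A k i j := by
      rw [← LinearMap.toMatrixAlgEquiv_apply]
      exact congrFun₂ ((Φ.trans (LinearMap.toMatrixAlgEquiv e)).apply_symm_apply (A k)) i j
    rw [h]
    fin_cases k <;> fin_cases i <;> fin_cases j <;> simp [A]
  · simp only [trd_symm_mul_symm]
    have h : (Matrix.of fun i j : Fin 4 => (A i * A j).trace) =
        !![1, 0, 0, 0; 0, 0, 1, 0; 0, 1, 0, 0; 0, 0, 0, 1] := by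
      ext i j
      fin_cases i <;> fin_cases j <;> simp [A, Matrix.trace_fin_two]
    rw [h]
    simp [Matrix.det_succ_row_zero, Fin.sum_univ_succ, Fin.succAbove]

/-- A rank-one idempotent is nonzero and not invertible. -/
theorem algebraDisc_eq_top (Φ : H ≃ₐ[F] Module.End F V) (hV : Module.finrank F V = 2) :
    algebraDisc F H = ⊤ := by
  have : FiniteDimensional F V := Module.finite_of_finrank_eq_succ hV
  let Ψ := Φ.trans (LinearMap.toMatrixAlgEquiv (Module.finBasisOfFinrankEq F V hV))
  rw [algebraDisc, if_neg]
  intro h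
  have h1 : (!![1, 0; 0, 0] : Matrix (Fin 2) (Fin 2) F) ≠ 0 := fun h => by
    simpa using congrFun₂ h 0 0
  have hu := (h (Ψ.symm !![1, 0; 0, 0]) (by simpa using h1)).map Ψ
  rw [AlgEquiv.apply_symm_apply, Matrix.isUnit_iff_isUnit_det] at hu
  simp at hu

end Local

/-! ### Gram matrices and modular bases -/

section Form

open ValuativeRel

variable {F V : Type*} [Field F] [ValuativeRel F] [AddCommGroup V] [Module F V]

/-- The lattice spanned by the basis `e` is `q𝔬`-modular for the form `b`: the Gram matrix of `b`
is `q` times an invertible integral matrix. -/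
def IsModularBasis (b : LinearMap.BilinForm F V) (e : Module.Basis (Fin 2) F V) (q : F) : Prop :=
  q ≠ 0 ∧ (∀ i j, valuation F (b (e i) (e j)) ≤ valuation F q) ∧
    valuation F (gramDet b e) = valuation F q ^ 2

/-- Subtracting an integral multiple of the first vector from the second. -/
theorem exists_basis_shear (e : Module.Basis (Fin 2) F V) {a : F} (ha : valuation F a ≤ 1) :
    ∃ f : Module.Basis (Fin 2) F V, f 0 = e 0 ∧ f 1 = e 1 - a • e 0 ∧
      Submodule.span 𝒪[F] (Set.range f) = Submodule.span 𝒪[F] (Set.range e) := by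
  have hF : ⊤ ≤ Submodule.span F (Set.range ![e 0, e 1 - a • e 0]) := by
    rw [← e.span_eq, Submodule.span_le, Set.range_subset_iff]
    have h0 : e 0 ∈ Submodule.span F (Set.range ![e 0, e 1 - a • e 0]) :=
      Submodule.subset_span ⟨0, rfl⟩
    have h1 : e 1 - a • e 0 ∈ Submodule.span F (Set.range ![e 0, e 1 - a • e 0]) :=
      Submodule.subset_span ⟨1, rfl⟩
    intro i
    fin_cases i
    · exact h0
    · have := Submodule.add_mem _ h1 (Submodule.smul_mem _ a h0)
      rwa [sub_add_cancel] at this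
  let f := basisOfTopLeSpanOfCardEqFinrank _ hF (Module.finrank_eq_card_basis e).symm
  have hf : ⇑f = ![e 0, e 1 - a • e 0] := coe_basisOfTopLeSpanOfCardEqFinrank ..
  have hf0 : f 0 = e 0 := by simp [hf]
  have hf1 : f 1 = e 1 - a • e 0 := by simp [hf]
  have hsmul : ∀ w : V, a • w = (⟨a, ha⟩ : 𝒪[F]) • w := fun w => rfl
  refine ⟨f, hf0, hf1, le_antisymm ?_ ?_⟩ <;> rw [Submodule.span_le, Set.range_subset_iff]
  · have h0 : e 0 ∈ Submodule.span 𝒪[F] (Set.range e) := Submodule.subset_span ⟨0, rfl⟩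
    have h1 : e 1 ∈ Submodule.span 𝒪[F] (Set.range e) := Submodule.subset_span ⟨1, rfl⟩
    intro i
    fin_cases i
    · simpa [hf0] using h0
    · have := Submodule.sub_mem _ h1 (Submodule.smul_mem _ ⟨a, ha⟩ h0)
      simpa [hf1, hsmul] using this
  · have h0 : f 0 ∈ Submodule.span 𝒪[F] (Set.range f) := Submodule.subset_span ⟨0, rfl⟩
    have h1 : f 1 ∈ Submodule.span 𝒪[F] (Set.range f) := Submodule.subset_span ⟨1, rfl⟩
    intro i
    fin_cases i
    · simpa [hf0] using h0
    · have := Submodule.add_mem _ h1 (Submodule.smul_mem _ ⟨a, ha⟩ h0)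
      rwa [hf1, ← hsmul, hf0, sub_add_cancel] at this

/-- If the first basis vector has a value of largest absolute value, it splits off. -/
theorem exists_orthogonal_basis {b : LinearMap.BilinForm F V} (hsymm : b.IsSymm)
    (e : Module.Basis (Fin 2) F V) (hdet : gramDet b e ≠ 0)
    (h01 : valuation F (b (e 0) (e 1)) ≤ valuation F (b (e 0) (e 0)))
    (h11 : valuation F (b (e 1) (e 1)) ≤ valuation F (b (e 0) (e 0))) :
    ∃ f : Module.Basis (Fin 2) F V,
      Submodule.span 𝒪[F] (Set.range f) = Submodule.span 𝒪[F] (Set.range e) ∧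
      b (f 0) (f 1) = 0 ∧ valuation F (b (f 1) (f 1)) ≤ valuation F (b (f 0) (f 0)) := by
  have hp : b (e 0) (e 0) ≠ 0 := fun hp => by
    have hq : b (e 0) (e 1) = 0 := by simpa [hp] using h01
    exact hdet (by simp [gramDet, hp, hq])
  -- The Gram–Schmidt coefficient is integral, so the shear by it keeps the lattice.
  have ha : valuation F (b (e 0) (e 1) / b (e 0) (e 0)) ≤ 1 := by
    rw [map_div₀]
    exact div_le_one_of_le₀ h01 zero_le
  obtain ⟨f, hf0, hf1, hf⟩ := exists_basis_shear e ha
  have h10 : b (e 1) (e 0) = b (e 0) (e 1) := hsymm.eq _ _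
  refine ⟨f, hf, ?_, ?_⟩
  · rw [hf0, hf1, map_sub, map_smul, smul_eq_mul, div_mul_cancel₀ _ hp, sub_self]
  · have hval : b (f 1) (f 1) =
        b (e 1) (e 1) - b (e 0) (e 1) / b (e 0) (e 0) * b (e 0) (e 1) := by
      simp only [hf1, map_sub, map_smul, LinearMap.sub_apply, LinearMap.smul_apply, smul_eq_mul,
        h10]
      field_simp
      ring
    rw [hval, hf0]
    refine Valuation.map_sub_le _ h11 ?_
    rw [map_mul]
    exact (mul_le_of_le_one_left' ha).trans h01

/-- A binary lattice is modular or has an orthogonal basis. -/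
theorem exists_modular_or_orthogonal {b : LinearMap.BilinForm F V} (hsymm : b.IsSymm)
    (hdet : ∀ e : Module.Basis (Fin 2) F V, gramDet b e ≠ 0) (e : Module.Basis (Fin 2) F V) :
    ∃ f : Module.Basis (Fin 2) F V,
      Submodule.span 𝒪[F] (Set.range f) = Submodule.span 𝒪[F] (Set.range e) ∧
      ((∃ q, IsModularBasis b f q) ∨
        b (f 0) (f 1) = 0 ∧ valuation F (b (f 1) (f 1)) ≤ valuation F (b (f 0) (f 0))) := by
  have h10 : b (e 1) (e 0) = b (e 0) (e 1) := hsymm.eq _ _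
  by_cases hA : valuation F (b (e 0) (e 1)) ≤ valuation F (b (e 0) (e 0)) ∧
      valuation F (b (e 1) (e 1)) ≤ valuation F (b (e 0) (e 0))
  · obtain ⟨f, hf, h⟩ := exists_orthogonal_basis hsymm e (hdet e) hA.1 hA.2
    exact ⟨f, hf, Or.inr h⟩
  by_cases hB : valuation F (b (e 0) (e 1)) ≤ valuation F (b (e 1) (e 1)) ∧
      valuation F (b (e 0) (e 0)) ≤ valuation F (b (e 1) (e 1))
  · obtain ⟨f, hf, h⟩ := exists_orthogonal_basis hsymm (e.reindex (Equiv.swap 0 1)) (hdet _)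
      (by simpa [h10] using hB.1) (by simpa using hB.2)
    refine ⟨f, ?_, Or.inr h⟩
    rw [hf, Module.Basis.range_reindex]
  -- Neither diagonal entry dominates, so the off-diagonal one strictly exceeds both and alone
  -- determines the size of the Gram determinant.
  have h0 : valuation F (b (e 0) (e 0)) < valuation F (b (e 0) (e 1)) := by
    by_contra! h
    exact hA ⟨h, le_of_not_ge fun h' => hB ⟨h.trans h', h'⟩⟩
  have h1 : valuation F (b (e 1) (e 1)) < valuation F (b (e 0) (e 1)) := by
    by_contra! h
    exact hB ⟨h, le_of_not_ge fun h' => hA ⟨h.trans h', h'⟩⟩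
  refine ⟨e, rfl, Or.inl ⟨b (e 0) (e 1), fun h => ?_, fun i j => ?_, ?_⟩⟩
  · rw [h, map_zero (valuation F)] at h0
    exact not_lt_zero h0
  · fin_cases i <;> fin_cases j
    · exact h0.le
    · exact le_rfl
    · exact (congrArg _ h10).le
    · exact h1.le
  · rw [gramDet, Valuation.map_sub_eq_of_lt_right, map_pow]
    rw [map_mul, map_pow, sq]
    exact mul_lt_mul'' h0 h1 zero_le zero_le

theorem mem_dualSubmodule_iff_valuation {b : LinearMap.BilinForm F V} {L : Submodule 𝒪[F] V}
    {y : V} : y ∈ b.dualSubmodule L ↔ ∀ w ∈ L, valuation F (b y w) ≤ 1 := by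
  rw [LinearMap.BilinForm.mem_dualSubmodule]
  refine forall₂_congr fun w _ => ?_
  rw [Submodule.mem_one]
  exact ⟨fun ⟨r, hr⟩ => hr ▸ r.2, fun h => ⟨⟨_, h⟩, rfl⟩⟩

/-- This is `Λ = qΛ♯` without division. The converse direction is Cramer's rule: each coordinate of
`y` times the Gram determinant, of size `|q|²`, is a difference of products of terms of size at most
`|q|`. -/
theorem IsModularBasis.mem_span_iff [TopologicalSpace F] [IsNonarchimedeanLocalField F]
    {b : LinearMap.BilinForm F V} (hsymm : b.IsSymm) {e : Module.Basis (Fin 2) F V} {q : F}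
    (he : IsModularBasis b e q) {y : V} :
    y ∈ Submodule.span 𝒪[F] (Set.range e) ↔
      ∀ w ∈ Submodule.span 𝒪[F] (Set.range e), valuation F (b y w) ≤ valuation F q := by
  obtain ⟨hq, hle, hdet⟩ := he
  have hq0 : 0 < valuation F q := (Valuation.pos_iff _).mpr hq
  have hy := e.sum_repr y
  rw [Fin.sum_univ_two] at hy
  constructor
  · intro h w hw
    rw [mem_span_range_basis_iff] at h hw
    rw [← hy, ← e.sum_repr w, Fin.sum_univ_two]
    simp only [map_add, map_smul, LinearMap.add_apply, LinearMap.smul_apply, smul_eq_mul]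
    refine Valuation.map_add_le _ ?_ ?_ <;> rw [map_mul] <;>
      refine (mul_le_of_le_one_left' (hw _)).trans (Valuation.map_add_le _ ?_ ?_) <;>
      rw [map_mul] <;> exact (mul_le_of_le_one_left' (h _)).trans (hle _ _)
  · intro h
    have h0 := h (e 0) (Submodule.subset_span ⟨0, rfl⟩)
    have h1 := h (e 1) (Submodule.subset_span ⟨1, rfl⟩)
    have hb0 : b y (e 0) = e.repr y 0 * b (e 0) (e 0) + e.repr y 1 * b (e 0) (e 1) := by
      rw [hsymm.eq (e 0) (e 1)]
      conv_lhs => rw [← hy]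
      simp
    have hb1 : b y (e 1) = e.repr y 0 * b (e 0) (e 1) + e.repr y 1 * b (e 1) (e 1) := by
      conv_lhs => rw [← hy]
      simp
    have key : ∀ c x₁ x₂ y₁ y₂ : F, c * gramDet b e = x₁ * y₁ - x₂ * y₂ →
        valuation F x₁ ≤ valuation F q → valuation F x₂ ≤ valuation F q →
        valuation F y₁ ≤ valuation F q → valuation F y₂ ≤ valuation F q →
        valuation F c ≤ 1 := by
      intro c x₁ x₂ y₁ y₂ hc hx₁ hx₂ hy₁ hy₂
      have h : valuation F (c * gramDet b e) ≤ valuation F q ^ 2 := by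
        rw [hc]
        refine Valuation.map_sub_le _ ?_ ?_ <;> rw [map_mul, sq] <;>
          exact mul_le_mul' ‹_› ‹_›
      rw [map_mul, hdet] at h
      exact le_of_mul_le_mul_right (by rwa [one_mul]) (pow_pos hq0 2)
    rw [mem_span_range_basis_iff]
    intro i
    fin_cases i
    · refine key _ _ _ _ _ ?_ h0 h1 (hle 1 1) (hle 0 1)
      rw [hb0, hb1, gramDet]
      simp only [Fin.zero_eta]
      ring
    · refine key _ _ _ _ _ ?_ h1 h0 (hle 0 0) (hle 0 1)
      rw [hb0, hb1, gramDet]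
      simp only [Fin.mk_one]
      ring

end Form

/-! ### Endomorphism orders of modular lattices -/

section Local

open ValuativeRel

variable {F H V : Type*} [Field F] [ValuativeRel F] [TopologicalSpace F]
  [IsNonarchimedeanLocalField F] [Ring H] [Algebra F H] [AddCommGroup V] [Module F V]

theorem IsModularBasis.mem_dualSubmodule_iff {b : LinearMap.BilinForm F V} (hsymm : b.IsSymm)
    {e : Module.Basis (Fin 2) F V} {q : F} (he : IsModularBasis b e q) {y : V} :
    y ∈ b.dualSubmodule (Submodule.span 𝒪[F] (Set.range e)) ↔
      q • y ∈ Submodule.span 𝒪[F] (Set.range e) := by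
  rw [mem_dualSubmodule_iff_valuation, he.mem_span_iff hsymm]
  refine forall₂_congr fun w _ => ?_
  rw [map_smul, LinearMap.smul_apply, smul_eq_mul, map_mul]
  have hq0 : 0 < valuation F q := (Valuation.pos_iff _).mpr he.1
  exact (mul_le_iff_le_one_right hq0).symm

theorem IsModularBasis.isIdealModular {b : LinearMap.BilinForm F V} (hsymm : b.IsSymm)
    {e : Module.Basis (Fin 2) F V} {q : F} (he : IsModularBasis b e q) :
    IsIdealModular b (FractionalIdeal.spanSingleton 𝒪[F]⁰ q)
      (Submodule.span 𝒪[F] (Set.range e)) := by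
  refine ⟨isLattice_span_range_basis e, ?_⟩
  rw [FractionalIdeal.coe_spanSingleton]
  refine le_antisymm (fun y hy => ?_) (Submodule.smul_le.mpr fun r hr y hy => ?_)
  · rw [← smul_inv_smul₀ he.1 y]
    refine Submodule.smul_mem_smul (Submodule.mem_span_singleton_self q) ?_
    rwa [he.mem_dualSubmodule_iff hsymm, smul_inv_smul₀ he.1]
  · obtain ⟨a, rfl⟩ := Submodule.mem_span_singleton.mp hr
    rw [smul_assoc]
    exact Submodule.smul_mem _ a ((he.mem_dualSubmodule_iff hsymm).mp hy)

/-- `Λ♯ = q⁻¹Λ` is homothetic to `Λ`. This makes the intersection in the main theorem collapse to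
`End(Λ)`. -/
theorem IsModularBasis.latticeEnd_le {b : LinearMap.BilinForm F V} (hsymm : b.IsSymm)
    {e : Module.Basis (Fin 2) F V} {q : F} (he : IsModularBasis b e q)
    (Φ : H ≃ₐ[F] Module.End F V) :
    latticeEnd Φ (Submodule.span 𝒪[F] (Set.range e)) ≤
      latticeEnd Φ (b.dualSubmodule (Submodule.span 𝒪[F] (Set.range e))) := by
  intro x hx y hy
  rw [he.mem_dualSubmodule_iff hsymm] at hy ⊢
  rw [← map_smul]
  exact hx _ hy

/-- Membership in `Λ` is tested by `b` against `Λ`, and adjointness moves `s x` to `x` on the other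
side. -/
theorem IsModularBasis.isInvolutionOrder {s : Involution F H} {Φ : H ≃ₐ[F] Module.End F V}
    {b : LinearMap.BilinForm F V} (hb : s.IsInducedBy Φ b)
    {e : Module.Basis (Fin 2) F V} {q : F} (he : IsModularBasis b e q) :
    IsInvolutionOrder s (latticeEnd Φ (Submodule.span 𝒪[F] (Set.range e))) := by
  have hstable : ∀ x ∈ latticeEnd Φ (Submodule.span 𝒪[F] (Set.range e)),
      s x ∈ latticeEnd Φ (Submodule.span 𝒪[F] (Set.range e)) := by
    intro x hx v hv
    rw [he.mem_span_iff hb.1]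
    intro w hw
    rw [← hb.2.2]
    exact (he.mem_span_iff hb.1).mp hv _ (hx w hw)
  refine ⟨?_, Set.Subset.antisymm ?_ fun x hx => ⟨s x, hstable x hx, s.apply_apply x⟩⟩
  · rw [latticeEnd_span_range_eq]
    exact isLattice_span_range_basis _
  · rintro _ ⟨x, hx, rfl⟩
    exact hstable x hx

/-! ### From stable orders to modular lattices -/

/-- Every order stabilizes a lattice, which has a basis over the principal ideal domain `𝔬`. -/
theorem exists_basis_le_latticeEnd (hV : Module.finrank F V = 2) (Φ : H ≃ₐ[F] Module.End F V)
    (O : Subalgebra 𝒪[F] H) (hO : Submodule.IsLattice F (Subalgebra.toSubmodule O)) :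
    ∃ e : Module.Basis (Fin 2) F V, O ≤ latticeEnd Φ (Submodule.span 𝒪[F] (Set.range e)) := by
  have : FiniteDimensional F V := Module.finite_of_finrank_eq_succ hV
  have : Nontrivial V := Module.nontrivial_of_finrank_pos (R := F) (by omega)
  obtain ⟨v, hv⟩ := exists_ne (0 : V)
  obtain ⟨f, hf⟩ := Module.Projective.exists_dual_eq_one F hv
  let φ : H →ₗ[F] V := LinearMap.applyₗ v ∘ₗ Φ.toLinearMap
  have hφ : ∀ x, φ x = Φ x v := fun x => rfl
  have hsurj : Function.Surjective φ := fun w =>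
    ⟨Φ.symm (LinearMap.smulRight f w), by simp [hφ, hf]⟩
  -- The lattice is `Ov` for a nonzero vector `v`; it is full because rank-one maps carry `v` to any
  -- vector.
  let L : Submodule 𝒪[F] V := (Subalgebra.toSubmodule O).map (φ.restrictScalars 𝒪[F])
  have hL : Submodule.IsLattice F L := by
    refine ⟨hO.fg.map _, ?_⟩
    have h : (L : Set V) = φ '' (Subalgebra.toSubmodule O : Set H) := rfl
    rw [h, Submodule.span_image, hO.span_eq_top, Submodule.map_top, LinearMap.range_eq_top]
    exact hsurj
  have : Module.Free 𝒪[F] L := Submodule.IsLattice.free F L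
  have : Module.Finite 𝒪[F] L := Module.Finite.iff_fg.mpr hL.fg
  have hrank : Module.finrank 𝒪[F] L = 2 := by
    rw [← hV]
    exact congrArg Cardinal.toNat (Submodule.IsLattice.rank' F L)
  let c := Module.finBasisOfFinrankEq 𝒪[F] L hrank
  have hspan : Submodule.span 𝒪[F] (Set.range (c.extendOfIsLattice F)) = L := by
    have h : (c.extendOfIsLattice F : Fin 2 → V) = L.subtype ∘ c :=
      funext fun k => c.extendOfIsLattice_apply F k
    rw [h, Set.range_comp, ← Submodule.map_span, c.span_eq, Submodule.map_top,
      Submodule.range_subtype]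
  refine ⟨c.extendOfIsLattice F, fun x hx => ?_⟩
  rw [hspan]
  rintro _ ⟨y, hy, rfl⟩
  refine ⟨x * y, O.mul_mem hx hy, ?_⟩
  change φ (x * y) = Φ x (φ y)
  rw [hφ, hφ, map_mul, Module.End.mul_apply]

/-- Rescaling the second vector of an orthogonal basis preserves stability under an order
which is invariant under the adjoint involution. -/
theorem le_latticeEnd_isUnitSMul {s : Involution F H} {Φ : H ≃ₐ[F] Module.End F V}
    {b : LinearMap.BilinForm F V} (hb : s.IsInducedBy Φ b) {O : Subalgebra 𝒪[F] H}
    (hO : ∀ x ∈ O, s x ∈ O) {e : Module.Basis (Fin 2) F V}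
    (he : O ≤ latticeEnd Φ (Submodule.span 𝒪[F] (Set.range e)))
    (h01 : b (e 0) (e 1) = 0) (h00 : b (e 0) (e 0) ≠ 0) {k : F} (hk1 : valuation F k ≤ 1)
    (hval : valuation F (b (e 1) (e 1)) = valuation F k ^ 2 * valuation F (b (e 0) (e 0)))
    {f : Module.Basis (Fin 2) F V} (hf0 : f 0 = e 0) (hf1 : f 1 = k⁻¹ • e 1)
    (hr0 : ∀ y, f.repr y 0 = e.repr y 0) (hr1 : ∀ y, f.repr y 1 = k * e.repr y 1) :
    O ≤ latticeEnd Φ (Submodule.span 𝒪[F] (Set.range f)) := by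
  intro x hx
  have hex := (mem_latticeEnd_span_range_iff e).mp (he hx)
  have hes := (mem_latticeEnd_span_range_iff e).mp (he (hO x hx))
  have h10 : b (e 1) (e 0) = 0 := (hb.1.eq _ _).trans h01
  -- Write `x₀₁` for the upper-right entry. Adjointness reads `x₀₁ b(e₀,e₀) = (s x)₁₀ b(e₁,e₁)` with
  -- `(s x)₁₀` integral.
  have hoff : valuation F (e.repr (Φ x (e 1)) 0) ≤ valuation F k ^ 2 := by
    have hadj := hb.2.2 x (e 0) (e 1)
    have hx1 := e.sum_repr (Φ x (e 1))
    have hs0 := e.sum_repr (Φ (s x) (e 0))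
    rw [Fin.sum_univ_two] at hx1 hs0
    rw [← hx1, ← hs0] at hadj
    simp only [map_add, map_smul, LinearMap.add_apply, LinearMap.smul_apply, smul_eq_mul,
      h01, mul_zero, add_zero, zero_add] at hadj
    have h := congrArg (valuation F) hadj
    rw [map_mul, map_mul, hval] at h
    have h00' : 0 < valuation F (b (e 0) (e 0)) := (Valuation.pos_iff _).mpr h00
    refine le_of_mul_le_mul_right (h.trans_le ?_) h00'
    exact mul_le_of_le_one_left' (hes 1 0)
  rw [mem_latticeEnd_span_range_iff]
  intro i j
  -- `k = 0` would make `f 1 = 0⁻¹ • e 1 = 0`, impossible for a basis vector.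
  rcases eq_or_ne k 0 with rfl | hk
  · exact absurd (by simpa using hf1) (f.ne_zero 1)
  have hk0 : valuation F k ≠ 0 := (Valuation.ne_zero_iff _).mpr hk
  -- The change of basis fixes the diagonal and turns the off-diagonal entries into `k⁻¹x₀₁` and `k
  -- x₁₀`; only the first needs `hoff`.
  fin_cases i <;> fin_cases j
  · simpa [hf0, hr0] using hex 0 0
  · simp only [Fin.zero_eta, Fin.mk_one, hf1, hr0, map_smul, Finsupp.smul_apply, smul_eq_mul,
      map_mul, map_inv₀]
    calc (valuation F k)⁻¹ * valuation F (e.repr (Φ x (e 1)) 0)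
        ≤ (valuation F k)⁻¹ * valuation F k ^ 2 := mul_le_mul' le_rfl hoff
      _ = valuation F k := by rw [sq, inv_mul_cancel_left₀ hk0]
      _ ≤ 1 := hk1
  · simp only [Fin.zero_eta, Fin.mk_one, hf0, hr1, map_mul]
    exact mul_le_one' hk1 (hex 1 0)
  · simp only [Fin.mk_one, hf1, hr1, map_smul, Finsupp.smul_apply, smul_eq_mul,
      inv_mul_cancel_left₀ hk]
    exact hex 1 1

/-- Every order invariant under the involution stabilizes a modular lattice, when the
discriminant of the involution contains a unit. -/
theorem exists_modular_le_latticeEnd (h2 : (2 : F) ≠ 0) (hV : Module.finrank F V = 2)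
    {s : Involution F H} {Φ : H ≃ₐ[F] Module.End F V} {z : F} (hz : z ∈ s.disc Φ)
    (hz1 : valuation F z = 1) {b : LinearMap.BilinForm F V} (hb : s.IsInducedBy Φ b)
    {O : Subalgebra 𝒪[F] H} (hO : IsInvolutionOrder s O) :
    ∃ (e : Module.Basis (Fin 2) F V) (q : F), IsModularBasis b e q ∧
      O ≤ latticeEnd Φ (Submodule.span 𝒪[F] (Set.range e)) := by
  obtain ⟨h, hh, h0, u, hu, hzu⟩ := hz
  have hdet : ∀ e : Module.Basis (Fin 2) F V, gramDet b e ≠ 0 := fun e he => by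
    obtain ⟨t, ht, hte⟩ := hb.gramDet_mul_nrd h2 e hh h0
    rw [he, zero_mul] at hte
    exact pow_ne_zero 2 ht hte.symm
  obtain ⟨e₀, he₀⟩ := exists_basis_le_latticeEnd hV Φ O hO.1
  obtain ⟨e, hspan, ⟨q, he⟩ | ⟨h01, h11⟩⟩ := exists_modular_or_orthogonal hb.1 hdet e₀
  · exact ⟨e, q, he, hspan ▸ he₀⟩
  rw [← hspan] at he₀
  have hg : gramDet b e = b (e 0) (e 0) * b (e 1) (e 1) := by rw [gramDet, h01]; ring
  have h00 : b (e 0) (e 0) ≠ 0 := fun hp => hdet e (by rw [hg, hp, zero_mul])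
  obtain ⟨t, ht, hte⟩ := hb.gramDet_mul_nrd h2 e hh h0
  rw [hg] at hte
  -- With diagonal entries `a, c` and `z = nrd h · u²`, the relation `a c · nrd h = t²` becomes `c z
  -- = (t u / a)² a`; as `|z| = 1`, this gives `|c| = |k|²|a|`.
  let k : F := t * u / b (e 0) (e 0)
  have hk : k ≠ 0 := div_ne_zero (mul_ne_zero ht hu) h00
  have hkz : b (e 1) (e 1) * z = k ^ 2 * b (e 0) (e 0) := by
    rw [hzu]
    simp only [k]
    field_simp
    linear_combination hte
  have hval : valuation F (b (e 1) (e 1)) = valuation F k ^ 2 * valuation F (b (e 0) (e 0)) := by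
    have h := congrArg (valuation F) hkz
    rwa [map_mul, map_mul, map_pow, hz1, mul_one] at h
  have h00' : 0 < valuation F (b (e 0) (e 0)) := (Valuation.pos_iff _).mpr h00
  have hk1 : valuation F k ≤ 1 := by
    rw [hval] at h11
    exact (pow_le_one_iff two_ne_zero).mp ((mul_le_iff_le_one_left h00').mp h11)
  have hw : ∀ i, IsUnit ((![1, k⁻¹] : Fin 2 → F) i) := by
    intro i
    fin_cases i
    · exact isUnit_one
    · exact (inv_ne_zero hk).isUnit
  -- The new Gram matrix is `diag(a, c / k²)`, with both entries of size `|a|`: it is `a𝔬`-modular.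
  let f := e.isUnitSMul hw
  have hf0 : f 0 = e 0 := by simp [f, Module.Basis.isUnitSMul_apply]
  have hf1 : f 1 = k⁻¹ • e 1 := by simp [f, Module.Basis.isUnitSMul_apply]
  have hr : ∀ y, f.repr y 0 = e.repr y 0 ∧ f.repr y 1 = k * e.repr y 1 := fun y => by
    have hy := congrArg e.repr (f.sum_repr y)
    rw [Fin.sum_univ_two, hf0, hf1] at hy
    constructor
    · simpa using DFunLike.congr_fun hy 0
    · have h := DFunLike.congr_fun hy 1
      simp only [map_add, map_smul, Module.Basis.repr_self, Finsupp.add_apply,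
        Finsupp.smul_apply, smul_eq_mul] at h
      rw [← h]
      simp [mul_comm k, hk]
  refine ⟨f, b (e 0) (e 0), ⟨h00, ?_, ?_⟩, le_latticeEnd_isUnitSMul hb
    (fun x hx => hO.2.subset ⟨x, hx, rfl⟩) he₀ h01 h00 hk1 hval hf0 hf1
    (fun y => (hr y).1) fun y => (hr y).2⟩
  all_goals
    have h10 : b (e 1) (e 0) = 0 := (hb.1.eq _ _).trans h01
    have hk0 : valuation F k ≠ 0 := (Valuation.ne_zero_iff _).mpr hk
    have hff : valuation F (b (f 1) (f 1)) = valuation F (b (e 0) (e 0)) := by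
      rw [hf1]
      simp only [map_smul, LinearMap.smul_apply, smul_eq_mul, map_mul, map_inv₀, hval]
      field_simp
  · intro i j
    fin_cases i <;> fin_cases j
    · simp [hf0]
    · simp [hf0, hf1, h01]
    · simp [hf0, hf1, h10]
    · exact hff.le
  · have : gramDet b f = b (e 0) (e 0) * b (f 1) (f 1) := by simp [gramDet, hf0, hf1, h01]
    rw [this, map_mul, hff, sq]

end Local

end QuatInv

/-! ### The main theorem -/

open QuatInv in
theorem mainTheorem5 {F H V : Type*} [Field F] [ValuativeRel F] [TopologicalSpace F]
    [IsNonarchimedeanLocalField F]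
    (hchar : (2 : F) ≠ 0) (hdyadic : (2 : 𝒪[F]) ∈ 𝓂[F])
    [Ring H] [Algebra F H] [AddCommGroup V] [Module F V]
    (hV : Module.finrank F V = 2) (Φ : H ≃ₐ[F] Module.End F V)
    (s : Involution F H) (hs : s.IsOrthogonal)
    (hdefect : quadraticDefectSet {x : F | x ∈ 𝒪[F] ∧ -x ∈ s.disc Φ} ≠ maximalIdealInField F) :
    (∃ b : LinearMap.BilinForm F V, s.IsInducedBy Φ b) ∧
    algebraDisc F H ⊓ iotaIdeal (s.disc Φ) = ⊤ ∧
    ∀ O : Subalgebra 𝒪[F] H, IsMaximalInvolutionOrder s O →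
      IsReducedDisc Φ O (algebraDisc F H ⊓ iotaIdeal (s.disc Φ)) ∧
      ∀ b : LinearMap.BilinForm F V, s.IsInducedBy Φ b →
        ∃ (𝔞 : FractionalIdeal 𝒪[F]⁰ F) (L : Submodule 𝒪[F] V),
          IsIdealModular b 𝔞 L ∧
          O = latticeEnd Φ L ⊓ latticeEnd Φ (b.dualSubmodule L) ∧
          latticeEnd Φ L ⊓ latticeEnd Φ (b.dualSubmodule L) = latticeEnd Φ L := by
  obtain ⟨b₀, hb₀⟩ := hs.exists_isInducedBy hchar hV Φ
  have : FiniteDimensional F V := Module.finite_of_finrank_eq_succ hV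
  have : Nontrivial s.skewPart := Module.nontrivial_of_finrank_pos (R := F) (by rw [hs.2]; omega)
  obtain ⟨⟨h, hh⟩, hne⟩ := exists_ne (0 : s.skewPart)
  have h0 : h ≠ 0 := fun hz => hne (Subtype.ext hz)
  have hn : nrd Φ h ≠ 0 := fun hn => by
    obtain ⟨t, ht, hte⟩ :=
      hb₀.gramDet_mul_nrd hchar (Module.finBasisOfFinrankEq F V hV) hh h0
    rw [hn, mul_zero] at hte
    exact pow_ne_zero 2 ht hte.symm
  obtain ⟨z, hz, hz1⟩ := Involution.exists_unit_mem_disc hh h0 hn hdefect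
  have htop : algebraDisc F H ⊓ iotaIdeal (s.disc Φ) = ⊤ := by
    rw [algebraDisc_eq_top Φ hV, iotaIdeal_eq_top hz hz1, inf_top_eq]
  have key : ∀ O : Subalgebra 𝒪[F] H, IsMaximalInvolutionOrder s O →
      ∀ b : LinearMap.BilinForm F V, s.IsInducedBy Φ b →
        ∃ (e : Module.Basis (Fin 2) F V) (q : F), IsModularBasis b e q ∧
          O = latticeEnd Φ (Submodule.span 𝒪[F] (Set.range e)) := by
    intro O hO b hb
    obtain ⟨e, q, he, hle⟩ := exists_modular_le_latticeEnd hchar hV hz hz1 hb hO.prop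
    -- `End(Λ)` is itself a stable order containing `O`, so maximality forces equality.
    exact ⟨e, q, he, hO.eq_of_le (he.isInvolutionOrder hb) hle⟩
  refine ⟨⟨b₀, hb₀⟩, htop, fun O hO => ⟨?_, fun b hb => ?_⟩⟩
  · obtain ⟨e, q, -, rfl⟩ := key O hO b₀ hb₀
    rw [IsReducedDisc, htop, discIdeal_latticeEnd_span_range, ← Ideal.one_eq_top, one_pow]
  · obtain ⟨e, q, he, rfl⟩ := key O hO b hb
    have hinf := inf_eq_left.mpr (he.latticeEnd_le hb.1 Φ)
    exact ⟨_, _, he.isIdealModular hb.1, hinf.symm, hinf⟩
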